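/- Identify $\mathbb{C}^a\otimes\mathbb{C}^b\otimes\mathbb{C}^c$ with arrays $T=(T_{i,j,k})$, on which $\mathrm{GL}=\mathrm{GL}_a(\mathbb{C})\times \mathrm{GL}_b(\mathbb{C})\times \mathrm{GL}_c(\mathbb{C})$ acts by $(A,B,C)\cdot T=(A\otimes B\otimes C)T$. For a nonzero tensor $S$, let $S_1\colon\mathbb{C}^a\to\mathbb{C}^b\otimes\mathbb{C}^c$, $S_2\colon\mathbb{C}^b\to\mathbb{C}^a\otimes\mathbb{C}^c$, $S_3\colon\mathbb{C}^c\to\mathbb{C}^a\otimes\mathbb{C}^b$ be its three flattenings, let $\mu_i(S)=S_i^*S_i/\operatorname{Tr}(S_i^*S_i)$, and let $\operatorname{spec}(\mu(S))=(\operatorname{spec}\mu_1(S)\mid\operatorname{spec}\mu_2(S)\mid\operatorname{spec}\mu_3(S))\in\mathbb{R}^a\times\mathbb{R}^b\times\mathbb{R}^c$, where $\operatorname{spec}$ lists the eigenvalues with multiplicity in non-increasing order. The moment polytope of a tensor $T$ is $$\Delta(T)=\{\operatorname{spec}(\mu(S)) : S\in\overline{\mathrm{GL}\cdot T}\setminus\{0\}\},$$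 with the closure in the Euclidean topology. Let $\langle r\rangle=\sum_{i=1}^r e_i\otimes e_i\otimes e_i\in\mathbb{C}^r\otimes\mathbb{C}^r\otimes\mathbb{C}^r$ be the unit tensor and let $\mathsf{M}_n=\sum_{i,j,k=1}^n e_{i,j}\otimes e_{j,k}\otimes e_{k,i}\in\mathbb{C}^{n^2}\otimes\mathbb{C}^{n^2}\otimes\mathbb{C}^{n^2}$ be the matrix multiplication tensor, where $e_{i,j}$ are the $n \times n$ matrix units, flattened along the rows to vectors in $\mathbb{C}^{n^2}$. Let $u_m=(1/m,\dots,1/m)\in\mathbb{R}^m$, also regarded as a vector in $\mathbb{R}^k$ for $k\ge m$ by padding with zeros; points and sets in $\mathbb{R}^c\times\mathbb{R}^c\times\mathbb{R}^c$ with $c\le n^2$ are compared with $\Delta(\mathsf{M}_n)\subseteq\mathbb{R}^{n^2}\times\mathbb{R}^{n^2}\times\mathbb{R}^{n^2}$ after padding each component with zeros. **Theorem.** Let $n,c\in\mathbb{N}$ satisfy $n^2-n+1<c\le n^2$. Then the point $p_c=(u_2\mid u_{c-1}\mid u_c)$ satisfies $p_c\in\Delta(\langle c\rangle)$ and $p_c\notin\Delta(\mathsf{M}_n)$;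 hence $\Delta(\langle c\rangle)\not\subseteq\Delta(\mathsf{M}_n)$. In particular, $\Delta(\langle n^2\rangle)\not\subseteq\Delta(\mathsf{M}_n)$ for every $n\ge 2$. -/

import Mathlib

open scoped Matrix

noncomputable section

namespace MomentPolytope

/-- Tensors in `ℂ^a ⊗ ℂ^b ⊗ ℂ^c`, in coordinates with respect to the standard bases. The topology
is the product topology, i.e. the Euclidean one. -/
abbrev Tensor (a b c : ℕ) : Type := Fin a → Fin b → Fin c → ℂ

/-- The simple tensor `u ⊗ v ⊗ w`. -/
def simpleTensor {a b c : ℕ} (u : Fin a → ℂ) (v : Fin b → ℂ) (w : Fin c → ℂ) : Tensor a b c :=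
  fun i j k => u i * v j * w k

/-- The unit tensor `⟨r⟩ = ∑ i, e_i ⊗ e_i ⊗ e_i` in `ℂ^r ⊗ ℂ^r ⊗ ℂ^r`. -/
def unitTensor (r : ℕ) : Tensor r r r :=
  ∑ i : Fin r, simpleTensor (Pi.single i 1) (Pi.single i 1) (Pi.single i 1)

/-- The `m × n` matrix unit `e_{i,j}`, flattened along the rows to a vector in `ℂ^(m n)`. -/
def matrixUnit {m n : ℕ} (i : Fin m) (j : Fin n) : Fin (m * n) → ℂ :=
  Pi.single (finProdFinEquiv (i, j)) 1

/-- The matrix multiplication tensor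
`M_{n₁,n₂,n₃} = ∑ i j k, e_{i,j} ⊗ e_{j,k} ⊗ e_{k,i}`. -/
def matMulTensor (n₁ n₂ n₃ : ℕ) : Tensor (n₁ * n₂) (n₂ * n₃) (n₃ * n₁) :=
  ∑ i : Fin n₁, ∑ j : Fin n₂, ∑ k : Fin n₃,
    simpleTensor (matrixUnit i j) (matrixUnit j k) (matrixUnit k i)

/-- The action `(A ⊗ B ⊗ C) T` of a triple of matrices on a tensor. -/
def act {a b c a' b' c' : ℕ} (A : Matrix (Fin a') (Fin a) ℂ) (B : Matrix (Fin b') (Fin b) ℂ)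
    (C : Matrix (Fin c') (Fin c) ℂ) (T : Tensor a b c) : Tensor a' b' c' :=
  fun i j k => ∑ x : Fin a, ∑ y : Fin b, ∑ z : Fin c, A i x * B j y * C k z * T x y z

/-- The orbit of `T` under `GL_a × GL_b × GL_c`. -/
def orbit {a b c : ℕ} (T : Tensor a b c) : Set (Tensor a b c) :=
  {S | ∃ (A : GL (Fin a) ℂ) (B : GL (Fin b) ℂ) (C : GL (Fin c) ℂ),
    S = act (A : Matrix (Fin a) (Fin a) ℂ) (B : Matrix (Fin b) (Fin b) ℂ)
      (C : Matrix (Fin c) (Fin c) ℂ) T}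

/-- The matrix of `T₁ : ℂ^a → ℂ^b ⊗ ℂ^c`. -/
def flattening₁ {a b c : ℕ} (T : Tensor a b c) : Matrix (Fin b × Fin c) (Fin a) ℂ :=
  Matrix.of fun p i => T i p.1 p.2

/-- The matrix of `T₂ : ℂ^b → ℂ^a ⊗ ℂ^c`. -/
def flattening₂ {a b c : ℕ} (T : Tensor a b c) : Matrix (Fin a × Fin c) (Fin b) ℂ :=
  Matrix.of fun p j => T p.1 j p.2

/-- The matrix of `T₃ : ℂ^c → ℂ^a ⊗ ℂ^b`. -/
def flattening₃ {a b c : ℕ} (T : Tensor a b c) : Matrix (Fin a × Fin b) (Fin c) ℂ :=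
  Matrix.of fun p k => T p.1 p.2 k

/-- The normalised Gram matrix `M* M / Tr (M* M)`. -/
def normalizedGram {ι κ : Type*} [Fintype ι] [Fintype κ] (M : Matrix ι κ ℂ) : Matrix κ κ ℂ :=
  (Mᴴ * M).trace⁻¹ • (Mᴴ * M)

theorem normalizedGram_isHermitian {ι κ : Type*} [Fintype ι] [Fintype κ] (M : Matrix ι κ ℂ) :
    (normalizedGram M).IsHermitian := by
  have h : (Mᴴ * M)ᴴ = Mᴴ * M := Matrix.isHermitian_conjTranspose_mul_self M
  unfold Matrix.IsHermitian normalizedGram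
  rw [Matrix.conjTranspose_smul, star_inv₀, ← Matrix.trace_conjTranspose, h]

/-- The eigenvalues of a Hermitian matrix, with multiplicity, in non-increasing order. -/
def spec {n : ℕ} {M : Matrix (Fin n) (Fin n) ℂ} (hM : M.IsHermitian) : Fin n → ℝ :=
  fun i => hM.eigenvalues₀ (Fin.cast (Fintype.card_fin n).symm i)

theorem spec_antitone {n : ℕ} {M : Matrix (Fin n) (Fin n) ℂ} (hM : M.IsHermitian) :
    Antitone (spec hM) :=
  fun _ _ h => hM.eigenvalues₀_antitone h

/-- `spec (μ T) = (spec (μ₁ T) | spec (μ₂ T) | spec (μ₃ T))`, where `μ` is the moment map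
`μ_i T = T_i* T_i / Tr (T_i* T_i)` for a nonzero tensor `T`. -/
def specMoment {a b c : ℕ} (T : Tensor a b c) : (Fin a → ℝ) × (Fin b → ℝ) × (Fin c → ℝ) :=
  (spec (normalizedGram_isHermitian (flattening₁ T)),
    spec (normalizedGram_isHermitian (flattening₂ T)),
    spec (normalizedGram_isHermitian (flattening₃ T)))

/-- The set `Δ(W) = {spec (μ S) | S ∈ W ∖ {0}}`. -/
def polytopeOfSet {a b c : ℕ} (W : Set (Tensor a b c)) :
    Set ((Fin a → ℝ) × (Fin b → ℝ) × (Fin c → ℝ)) :=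
  specMoment '' (W \ {0})

/-- The moment polytope `Δ(T)` of a tensor: `Δ(W)` for `W` the closure of the orbit of `T`. -/
def momentPolytope {a b c : ℕ} (T : Tensor a b c) :
    Set ((Fin a → ℝ) × (Fin b → ℝ) × (Fin c → ℝ)) :=
  polytopeOfSet (closure (orbit T))

/-- The uniform probability vector `u_m`, as a vector in `ℝ^k` for `m ≤ k` (padded with zeros). -/
def uniformVec (m k : ℕ) : Fin k → ℝ :=
  fun i => if (i : ℕ) < m then 1 / (m : ℝ) else 0

/-- The point `p_c = (u_2 | u_{c-1} | u_c)` in `ℝ^k × ℝ^k × ℝ^k`, for `c ≤ k`. -/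
def uniformPoint (c k : ℕ) : (Fin k → ℝ) × (Fin k → ℝ) × (Fin k → ℝ) :=
  (uniformVec 2 k, uniformVec (c - 1) k, uniformVec c k)

/-- The vector `v ∈ ℝ^m` padded with zeros to a vector in `ℝ^k`, for `m ≤ k`. -/
def padVec {m : ℕ} (k : ℕ) (v : Fin m → ℝ) : Fin k → ℝ :=
  fun i => if h : (i : ℕ) < m then v ⟨i, h⟩ else 0

/-- A point of `ℝ^m × ℝ^m × ℝ^m` padded with zeros to a point of `ℝ^k × ℝ^k × ℝ^k`. -/
def padPoint {m : ℕ} (k : ℕ) (p : (Fin m → ℝ) × (Fin m → ℝ) × (Fin m → ℝ)) :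
    (Fin k → ℝ) × (Fin k → ℝ) × (Fin k → ℝ) :=
  (padVec k p.1, padVec k p.2.1, padVec k p.2.2)

end MomentPolytope

end

/-! Non-membership rests on two incompatible properties. For a tensor in the orbit of `M_n`, a
two-dimensional space of vectors in the first factor is a pencil of `n × n` matrices, so it has a
singular member `u`. If `ξ` spans a line in its kernel, then contracting with `u` and any `ξ ⊗ η`
gives zero. These `ξ ⊗ η` form an `n`-dimensional space, which meets every subspace of dimension
greater than `n² - n` in the second factor. By compactness of the unit spheres this passes to the
orbit closure (`exists_contract_eq_zero_of_mem_closure_orbit`).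

Now let `S` have spectrum `p_c` and squared norm `t`. Take the spans of the eigenvectors of `μ₁` and
`μ₂` with nonzero eigenvalue, of dimensions `2` and `c - 1 > n² - n`. Suppose that unit vectors `u`,
`x` in them satisfy `S(u, x, ·) = 0`. Then the slice `S(·, x, ·)`, of squared norm `t / (c - 1)`, is
carried by the unit vector `u'` orthogonal to `u`, so `z = S(u', x, ·)` has squared norm `t / (c -
1)`. But every eigenvalue of `μ₃` is at most `1 / c`, which forces `‖z‖² ≤ t / c`, a contradiction
(`exists_contract_ne_zero`).

Membership is witnessed by multiplication of binary linear forms with forms of degree `c - 2`,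
written in bases orthonormal for the `SU(2)`-invariant inner products. Evaluation at `c` points and
interpolation make it a restriction of `⟨c⟩` (`pencil_mem_closure_orbit`). Equivariance and Schur's
lemma explain why its marginals are uniform; `specMoment_pencil` verifies this by direct summation.
-/

namespace MomentPolytope

open scoped Topology

/-! ### Norms and spectra of Gram matrices -/

/-- The squared Euclidean norm of a complex vector. -/
noncomputable def normSq {ι : Type*} [Fintype ι] (x : ι → ℂ) : ℝ := ∑ i, ‖x i‖ ^ 2

theorem ofReal_normSq {ι : Type*} [Fintype ι] (x : ι → ℂ) :
    ((normSq x : ℝ) : ℂ) = star x ⬝ᵥ x := by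
  simp only [normSq, dotProduct, Pi.star_apply, Complex.ofReal_sum]
  refine Finset.sum_congr rfl fun i _ => ?_
  rw [← starRingEnd_apply, Complex.conj_mul', Complex.ofReal_pow]

theorem normSq_nonneg {ι : Type*} [Fintype ι] (x : ι → ℂ) : 0 ≤ normSq x :=
  Finset.sum_nonneg fun _ _ => by positivity

theorem normSq_eq_zero {ι : Type*} [Fintype ι] {x : ι → ℂ} : normSq x = 0 ↔ x = 0 := by
  rw [normSq, Finset.sum_eq_zero_iff_of_nonneg fun _ _ => by positivity]
  simp [funext_iff]

theorem normSq_smul {ι : Type*} [Fintype ι] (z : ℂ) (x : ι → ℂ) :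
    normSq (z • x) = ‖z‖ ^ 2 * normSq x := by
  simp [normSq, mul_pow, Finset.mul_sum]

theorem exists_smul_normSq_eq_one {ι : Type*} [Fintype ι] {x : ι → ℂ} (hx : x ≠ 0) :
    ∃ z : ℂ, normSq (z • x) = 1 := by
  have h : 0 < normSq x := lt_of_le_of_ne (normSq_nonneg x) fun h => hx (normSq_eq_zero.1 h.symm)
  refine ⟨((√(normSq x))⁻¹ : ℝ), ?_⟩
  rw [normSq_smul, Complex.norm_real, Real.norm_eq_abs, sq_abs, inv_pow, Real.sq_sqrt h.le]
  exact inv_mul_cancel₀ h.ne'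

theorem normSq_mulVec_of_conjTranspose_mul_self {ι κ : Type*} [Fintype ι] [Fintype κ]
    [DecidableEq κ] {U : Matrix ι κ ℂ} (hU : Uᴴ * U = 1) (w : κ → ℂ) :
    normSq (U *ᵥ w) = normSq w := by
  apply Complex.ofReal_injective
  rw [ofReal_normSq, ofReal_normSq, Matrix.star_mulVec, ← Matrix.dotProduct_mulVec,
    Matrix.mulVec_mulVec, hU, Matrix.one_mulVec]

theorem norm_dotProduct_sq_le {ι : Type*} [Fintype ι] (x y : ι → ℂ) :
    ‖x ⬝ᵥ y‖ ^ 2 ≤ normSq x * normSq y := by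
  calc ‖x ⬝ᵥ y‖ ^ 2 ≤ (∑ i, ‖x i‖ * ‖y i‖) ^ 2 := by
        gcongr
        exact (norm_sum_le _ _).trans_eq (by simp)
    _ ≤ _ := Finset.sum_mul_sq_le_sq_mul_sq _ _ _

theorem exists_unitary_conj_eq_diagonal_spec {n : ℕ} {M : Matrix (Fin n) (Fin n) ℂ}
    (hM : M.IsHermitian) :
    ∃ U : Matrix (Fin n) (Fin n) ℂ, Uᴴ * U = 1 ∧ U * Uᴴ = 1 ∧
      Uᴴ * M * U = Matrix.diagonal fun i => (spec hM i : ℂ) := by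
  let e : Fin (Fintype.card (Fin n)) ≃ Fin n := Fintype.equivOfCardEq (Fintype.card_fin _)
  -- `eigenvalues` lists `eigenvalues₀` through the equivalence `e`; permuting the eigenvectors by
  -- `σ` restores the non-increasing order.
  let σ : Fin n ≃ Fin n := (finCongr (Fintype.card_fin n).symm).trans e
  let V : Matrix (Fin n) (Fin n) ℂ := hM.eigenvectorUnitary
  have hV : Vᴴ * V = 1 := Unitary.coe_star_mul_self hM.eigenvectorUnitary
  have hV' : V * Vᴴ = 1 := Unitary.coe_mul_star_self hM.eigenvectorUnitary
  have hd : Vᴴ * M * V = Matrix.diagonal (RCLike.ofReal ∘ hM.eigenvalues) := by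
    have := hM.conjStarAlgAut_star_eigenvectorUnitary
    rwa [Unitary.conjStarAlgAut_star_apply] at this
  refine ⟨V.submatrix id σ, ?_, ?_, ?_⟩
  · rw [Matrix.conjTranspose_submatrix,
      ← Matrix.submatrix_mul _ _ _ _ _ Function.bijective_id,
      hV, Matrix.submatrix_one_equiv]
  · rw [Matrix.conjTranspose_submatrix, Matrix.submatrix_mul_equiv, hV']
    simp
  · have : (V.submatrix id σ)ᴴ * M * V.submatrix id σ = (Vᴴ * M * V).submatrix σ σ := by
      ext i j
      simp [Matrix.mul_apply]
    rw [this, hd, Matrix.submatrix_diagonal_equiv]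
    congr 1
    funext i
    simp [spec, Matrix.IsHermitian.eigenvalues, σ, e]

/-- Both sides list the roots of the characteristic polynomial, and a multiset has only one
non-increasing enumeration. -/
theorem spec_eq_of_eq_diagonal {n : ℕ} {M : Matrix (Fin n) (Fin n) ℂ} (hM : M.IsHermitian)
    {d : Fin n → ℝ} (hd : Antitone d) (h : M = Matrix.diagonal fun i => (d i : ℂ)) :
    spec hM = d := by
  have h₁ := hM.roots_charpoly_eq_eigenvalues₀
  have h₂ : M.charpoly.roots = Multiset.map (fun i => (d i : ℂ)) Finset.univ.val := by
    rw [h, Matrix.charpoly_diagonal, Polynomial.roots_prod]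
    · simp
    · simp [Finset.prod_ne_zero_iff, Polynomial.X_sub_C_ne_zero]
  have h₃ : Multiset.map (spec hM) Finset.univ.val = Multiset.map d Finset.univ.val := by
    apply Multiset.map_injective Complex.ofReal_injective
    rw [Multiset.map_map, Multiset.map_map]
    refine Eq.trans ?_ (h₁.symm.trans h₂)
    have := Finset.univ.val.map_map (RCLike.ofReal ∘ hM.eigenvalues₀ : _ → ℂ)
      (finCongr (Fintype.card_fin n).symm)
    rw [← Multiset.map_univ_val_equiv (finCongr (Fintype.card_fin n).symm), this]
    rfl
  rw [Fin.univ_val_map, Fin.univ_val_map, Multiset.coe_eq_coe] at h₃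
  exact List.ofFn_injective
    (h₃.eq_of_sortedGE (spec_antitone hM).sortedGE_ofFn hd.sortedGE_ofFn)

theorem trace_conjTranspose_mul_self {ι κ : Type*} [Fintype ι] [Fintype κ] (M : Matrix ι κ ℂ) :
    (Mᴴ * M).trace = ((∑ p, ∑ i, ‖M p i‖ ^ 2 : ℝ) : ℂ) := by
  rw [Finset.sum_comm]
  simp [Matrix.trace, Matrix.mul_apply, Complex.conj_mul']

/-- In an eigenbasis of `Mᴴ * M`, the quadratic form of `Mᴴ * M` is diagonal. -/
theorem exists_unitary_normSq_mulVec {ι : Type*} [Fintype ι] {n : ℕ} (M : Matrix ι (Fin n) ℂ)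
    {t : ℝ} (ht : 0 < t) (hM : ∑ p, ∑ i, ‖M p i‖ ^ 2 = t) :
    ∃ U : Matrix (Fin n) (Fin n) ℂ, Uᴴ * U = 1 ∧ U * Uᴴ = 1 ∧
      ∀ w, normSq (M *ᵥ (U *ᵥ w)) =
        t * ∑ i, spec (normalizedGram_isHermitian M) i * ‖w i‖ ^ 2 := by
  obtain ⟨U, h₁, h₂, h₃⟩ := exists_unitary_conj_eq_diagonal_spec (normalizedGram_isHermitian M)
  refine ⟨U, h₁, h₂, fun w => ?_⟩
  have ht' : (t : ℂ) ≠ 0 := by exact_mod_cast ht.ne'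
  have hG : Mᴴ * M = (t : ℂ) • normalizedGram M := by
    rw [normalizedGram, trace_conjTranspose_mul_self, hM, smul_smul, mul_inv_cancel₀ ht', one_smul]
  apply Complex.ofReal_injective
  rw [ofReal_normSq, Matrix.star_mulVec, Matrix.star_mulVec, ← Matrix.dotProduct_mulVec,
    ← Matrix.dotProduct_mulVec, Matrix.mulVec_mulVec, Matrix.mulVec_mulVec, Matrix.mulVec_mulVec,
    Matrix.mul_assoc Uᴴ, hG, Matrix.mul_smul, Matrix.smul_mul, h₃,
    Matrix.smul_mulVec, dotProduct_smul, smul_eq_mul, Complex.ofReal_mul, Complex.ofReal_sum]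
  congr 1
  simp only [dotProduct, Matrix.mulVec_diagonal, Pi.star_apply]
  refine Finset.sum_congr rfl fun i _ => ?_
  rw [mul_left_comm, ← starRingEnd_apply, Complex.conj_mul']
  push_cast
  rfl

/-! ### Vanishing contractions on the orbit closure of matrix multiplication -/

/-- The contraction of a tensor with vectors in its first two factors. -/
noncomputable def contract {a b c : ℕ} (T : Tensor a b c) (u : Fin a → ℂ) (x : Fin b → ℂ) :
    Fin c → ℂ :=
  fun k => ∑ i, ∑ j, u i * x j * T i j k

theorem contract_act {a b c : ℕ} (A : Matrix (Fin a) (Fin a) ℂ) (B : Matrix (Fin b) (Fin b) ℂ)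
    (C : Matrix (Fin c) (Fin c) ℂ) (T : Tensor a b c) (u : Fin a → ℂ) (x : Fin b → ℂ) :
    contract (act A B C T) u x = C *ᵥ contract T (Aᵀ *ᵥ u) (Bᵀ *ᵥ x) := by
  funext k
  simp only [contract, act, Matrix.mulVec, dotProduct, Matrix.transpose_apply, Finset.mul_sum,
    Finset.sum_mul]
  have h₁ : ∀ F : Fin a → Fin b → Fin a → Fin b → Fin c → ℂ,
      ∑ i, ∑ j, ∑ p, ∑ q, ∑ r, F i j p q r = ∑ r, ∑ p, ∑ q, ∑ j, ∑ i, F i j p q r := by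
    intro F
    let e : Fin a × Fin b × Fin a × Fin b × Fin c ≃ Fin c × Fin a × Fin b × Fin b × Fin a :=
      { toFun := fun s => (s.2.2.2.2, s.2.2.1, s.2.2.2.1, s.2.1, s.1)
        invFun := fun s => (s.2.2.2.2, s.2.2.2.1, s.2.1, s.2.2.1, s.1)
        left_inv := fun _ => rfl
        right_inv := fun _ => rfl }
    have := Fintype.sum_equiv e (fun s => F s.1 s.2.1 s.2.2.1 s.2.2.2.1 s.2.2.2.2)
      (fun s => F s.2.2.2.2 s.2.2.2.1 s.2.1 s.2.2.1 s.1) fun _ => rfl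
    simpa only [Fintype.sum_prod_type] using this
  rw [h₁]
  refine Finset.sum_congr rfl fun r _ => Finset.sum_congr rfl fun p _ =>
    Finset.sum_congr rfl fun q _ => Finset.sum_congr rfl fun j _ =>
    Finset.sum_congr rfl fun i _ => ?_
  ring

theorem matMulTensor_apply {n₁ n₂ n₃ : ℕ} (i i' : Fin n₁) (j j' : Fin n₂) (k k' : Fin n₃) :
    matMulTensor n₁ n₂ n₃ (finProdFinEquiv (i, j)) (finProdFinEquiv (j', k))
      (finProdFinEquiv (k', i')) = if i = i' ∧ j = j' ∧ k = k' then 1 else 0 := by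
  simp only [matMulTensor, simpleTensor, matrixUnit, Finset.sum_apply, Pi.single_apply,
    EmbeddingLike.apply_eq_iff_eq, Prod.mk.injEq, ite_and, mul_ite, mul_one, mul_zero]
  simp only [Finset.sum_ite_eq, Finset.mem_univ, if_true, Finset.sum_ite_irrel,
    Finset.sum_const_zero]
  split_ifs <;> simp_all

theorem contract_matMulTensor {n₁ n₂ n₃ : ℕ} (u : Fin (n₁ * n₂) → ℂ) (x : Fin (n₂ * n₃) → ℂ)
    (k : Fin n₃) (i : Fin n₁) :
    contract (matMulTensor n₁ n₂ n₃) u x (finProdFinEquiv (k, i)) =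
      ∑ j, u (finProdFinEquiv (i, j)) * x (finProdFinEquiv (j, k)) := by
  simp only [contract]
  rw [← finProdFinEquiv.sum_comp, Fintype.sum_prod_type]
  simp_rw [← (finProdFinEquiv (m := n₂) (n := n₃)).sum_comp, Fintype.sum_prod_type,
    matMulTensor_apply, ite_and, mul_ite, mul_one, mul_zero]
  simp [Finset.sum_ite_irrel]

/-- Every pencil of square matrices over `ℂ` of positive size has a singular member. -/
theorem exists_ne_zero_det_eq_zero {n : ℕ} (hn : 0 < n)
    (X : (Fin 2 → ℂ) →ₗ[ℂ] Matrix (Fin n) (Fin n) ℂ) : ∃ v ≠ 0, (X v).det = 0 := by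
  have : Nonempty (Fin n) := ⟨⟨0, hn⟩⟩
  by_cases h : (X ![0, 1]).det = 0
  · exact ⟨![0, 1], fun h0 => by simpa using congrFun h0 1, h⟩
  have hu : IsUnit (X ![0, 1]).det := isUnit_iff_ne_zero.2 h
  -- With `X₀ = X ![1, 0]` and `X₁ = X ![0, 1]`, an eigenvalue `z` of `X₁⁻¹ X₀` makes `z X₁ - X₀`
  -- singular.
  obtain ⟨z, hz⟩ := IsAlgClosed.exists_root ((X ![0, 1])⁻¹ * X ![1, 0]).charpoly (by
    rw [Matrix.charpoly_degree_eq_dim]; simpa using hn.ne')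
  rw [Polynomial.IsRoot, Matrix.eval_charpoly] at hz
  refine ⟨![-1, z], fun h0 => by simpa using congrFun h0 0, ?_⟩
  have : X ![-1, z] = X ![0, 1] * (Matrix.scalar (Fin n) z - (X ![0, 1])⁻¹ * X ![1, 0]) := by
    rw [mul_sub, Matrix.mul_nonsing_inv_cancel_left _ _ hu, Matrix.scalar_apply,
      ← Matrix.smul_one_eq_diagonal]
    have : (![-1, z] : Fin 2 → ℂ) = z • ![0, 1] - ![1, 0] := by
      ext i; fin_cases i <;> simp
    rw [this, map_sub, map_smul]
    simp
  rw [this, Matrix.det_mul, hz, mul_zero]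

/-- For a tensor in the orbit of `M_n`, every pencil of slices along the first factor has a member
of corank at least `n`, whose kernel meets every subspace of dimension larger than `n² - n`. -/
theorem exists_contract_eq_zero_of_mem_orbit {n m : ℕ} (hn : 0 < n) (hm : n * n < m + n)
    (V : Matrix (Fin (n * n)) (Fin 2) ℂ) (E : Matrix (Fin (n * n)) (Fin m) ℂ)
    {T : Tensor (n * n) (n * n) (n * n)} (hT : T ∈ orbit (matMulTensor n n n)) :
    ∃ v w, normSq v = 1 ∧ normSq w = 1 ∧ contract T (V *ᵥ v) (E *ᵥ w) = 0 := by
  obtain ⟨A, B, C, rfl⟩ := hT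
  generalize (A : Matrix (Fin (n * n)) (Fin (n * n)) ℂ) = A
  generalize (B : Matrix (Fin (n * n)) (Fin (n * n)) ℂ) = B
  generalize (C : Matrix (Fin (n * n)) (Fin (n * n)) ℂ) = C
  let X : (Fin 2 → ℂ) →ₗ[ℂ] Matrix (Fin n) (Fin n) ℂ :=
    { toFun := fun v => Matrix.of fun i j => (Aᵀ *ᵥ V *ᵥ v) (finProdFinEquiv (i, j))
      map_add' := fun v w => by ext; simp [Matrix.mulVec_add]
      map_smul' := fun z v => by ext; simp [Matrix.mulVec_smul] }
  obtain ⟨v, hv, hdet⟩ := exists_ne_zero_det_eq_zero hn X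
  obtain ⟨ξ, hξ, hXξ⟩ := Matrix.exists_mulVec_eq_zero_iff.2 hdet
  -- `Φ (w, η) = Bᵀ E w - ξ ⊗ η`. Since `m + n > n²` it has a nonzero kernel vector, which puts `Bᵀ
  -- E w` in the space of all `ξ ⊗ η`.
  let Φ : ((Fin m → ℂ) × (Fin n → ℂ)) →ₗ[ℂ] (Fin (n * n) → ℂ) :=
    (Bᵀ * E).mulVecLin.comp (LinearMap.fst ℂ _ _) -
      { toFun := fun s p => ξ (finProdFinEquiv.symm p).1 * s.2 (finProdFinEquiv.symm p).2
        map_add' := fun s s' => by ext; simp [mul_add]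
        map_smul' := fun z s => by ext; simp [mul_left_comm] }
  have hker : LinearMap.ker Φ ≠ ⊥ := LinearMap.ker_ne_bot_of_finrank_lt (by simpa using hm)
  obtain ⟨⟨w, η⟩, hΦ, hne⟩ := Submodule.exists_mem_ne_zero_of_ne_bot hker
  have hΦ' : ∀ j k, (Bᵀ *ᵥ E *ᵥ w) (finProdFinEquiv (j, k)) = ξ j * η k := fun j k => by
    have := congrFun (LinearMap.mem_ker.1 hΦ) (finProdFinEquiv (j, k))
    rw [LinearMap.sub_apply, Pi.sub_apply, Pi.zero_apply, sub_eq_zero] at this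
    rw [Matrix.mulVec_mulVec]
    simpa only [LinearMap.comp_apply, LinearMap.fst_apply, Matrix.mulVecLin_apply,
      LinearMap.coe_mk, AddHom.coe_mk, Equiv.symm_apply_apply] using this
  -- If `w = 0`, then `ξ ⊗ η = 0` with `ξ ≠ 0`, so `η = 0` as well.
  have hw : w ≠ 0 := by
    rintro rfl
    obtain ⟨j, hj⟩ := Function.ne_iff.1 hξ
    refine hne (Prod.ext rfl (funext fun k => ?_))
    have := hΦ' j k
    simp only [Matrix.mulVec_zero, Pi.zero_apply] at this
    exact (mul_eq_zero.1 this.symm).resolve_left hj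
  have hzero : contract (matMulTensor n n n) (Aᵀ *ᵥ V *ᵥ v) (Bᵀ *ᵥ E *ᵥ w) = 0 := by
    funext p
    obtain ⟨⟨k, i⟩, rfl⟩ := finProdFinEquiv.surjective p
    rw [contract_matMulTensor]
    have := congrFun hXξ i
    simp only [Matrix.mulVec, dotProduct] at this
    calc _ = (∑ j, X v i j * ξ j) * η k := by
          rw [Finset.sum_mul]
          exact Finset.sum_congr rfl fun j _ => by rw [hΦ', ← mul_assoc]; rfl
      _ = 0 := by rw [this]; simp
  obtain ⟨z, hz⟩ := exists_smul_normSq_eq_one hv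
  obtain ⟨z', hz'⟩ := exists_smul_normSq_eq_one hw
  refine ⟨z • v, z' • w, hz, hz', ?_⟩
  have hsm : ∀ (T : Tensor (n * n) (n * n) (n * n)) (u x : Fin (n * n) → ℂ),
      contract T (z • u) (z' • x) = (z * z') • contract T u x := by
    intro T u x
    funext k
    simp only [contract, Pi.smul_apply, smul_eq_mul, Finset.mul_sum]
    exact Finset.sum_congr rfl fun i _ => Finset.sum_congr rfl fun j _ => by ring
  rw [Matrix.mulVec_smul, Matrix.mulVec_smul, hsm, contract_act, hzero]
  simp

theorem isCompact_setOf_normSq_eq_one (m : ℕ) : IsCompact {v : Fin m → ℂ | normSq v = 1} := by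
  refine Metric.isCompact_of_isClosed_isBounded ?_ ?_
  · refine isClosed_eq ?_ continuous_const
    unfold normSq
    fun_prop
  · refine (Metric.isBounded_closedBall (x := (0 : Fin m → ℂ)) (r := 1)).subset fun v hv => ?_
    rw [mem_closedBall_zero_iff, pi_norm_le_iff_of_nonneg zero_le_one]
    intro i
    have : ‖v i‖ ^ 2 ≤ normSq v :=
      Finset.single_le_sum (f := fun i => ‖v i‖ ^ 2) (fun _ _ => by positivity)
        (Finset.mem_univ i)
    rw [hv] at this
    exact (sq_le_one_iff₀ (norm_nonneg _)).1 this

/-- The set is the projection of a closed set along a product of two unit spheres. The normalisation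
of `v` and `w` makes this product compact, hence the projection a closed map. -/
theorem isClosed_setOf_exists_contract_eq_zero {a b c l m : ℕ} (V : Matrix (Fin a) (Fin l) ℂ)
    (E : Matrix (Fin b) (Fin m) ℂ) :
    IsClosed {T : Tensor a b c |
      ∃ v w, normSq v = 1 ∧ normSq w = 1 ∧ contract T (V *ᵥ v) (E *ᵥ w) = 0} := by
  have := isCompact_iff_compactSpace.1
    ((isCompact_setOf_normSq_eq_one l).prod (isCompact_setOf_normSq_eq_one m))
  let K := ({v : Fin l → ℂ | normSq v = 1} ×ˢ {w : Fin m → ℂ | normSq w = 1} : Set _)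
  have h : IsClosed {s : K × Tensor a b c |
      contract s.2 (V *ᵥ s.1.1.1) (E *ᵥ s.1.1.2) = 0} := by
    refine isClosed_eq ?_ continuous_const
    unfold contract Matrix.mulVec dotProduct
    fun_prop
  convert isClosedMap_snd_of_compactSpace _ h using 1
  ext T
  constructor
  · rintro ⟨v, w, hv, hw, hT⟩
    exact ⟨(⟨(v, w), hv, hw⟩, T), hT, rfl⟩
  · rintro ⟨⟨⟨⟨v, w⟩, hv, hw⟩, T⟩, hT, rfl⟩
    exact ⟨v, w, hv, hw, hT⟩

theorem exists_contract_eq_zero_of_mem_closure_orbit {n m : ℕ} (hn : 0 < n) (hm : n * n < m + n)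
    (V : Matrix (Fin (n * n)) (Fin 2) ℂ) (E : Matrix (Fin (n * n)) (Fin m) ℂ)
    {T : Tensor (n * n) (n * n) (n * n)} (hT : T ∈ closure (orbit (matMulTensor n n n))) :
    ∃ v w, normSq v = 1 ∧ normSq w = 1 ∧ contract T (V *ᵥ v) (E *ᵥ w) = 0 :=
  closure_minimal (fun _ h => exists_contract_eq_zero_of_mem_orbit hn hm V E h)
    (isClosed_setOf_exists_contract_eq_zero V E) hT

/-! ### Nonvanishing contractions for tensors with spectrum `p_c` -/

theorem dotProduct_contract {a b c : ℕ} (T : Tensor a b c) (u : Fin a → ℂ) (x : Fin b → ℂ)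
    (y : Fin c → ℂ) :
    x ⬝ᵥ (fun j => (fun i => ∑ k, T i j k * y k) ⬝ᵥ u) = y ⬝ᵥ contract T u x := by
  simp only [dotProduct, contract, Finset.mul_sum, Finset.sum_mul]
  let e : Fin b × Fin a × Fin c ≃ Fin c × Fin a × Fin b :=
    { toFun := fun s => (s.2.2, s.2.1, s.1)
      invFun := fun s => (s.2.2, s.2.1, s.1)
      left_inv := fun _ => rfl
      right_inv := fun _ => rfl }
  have := Fintype.sum_equiv e (fun s => x s.1 * (T s.2.1 s.1 s.2.2 * y s.2.2 * u s.2.1))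
    (fun s => y s.1 * (u s.2.1 * x s.2.2 * T s.2.1 s.2.2 s.1)) fun s => by
      simp only [e, Equiv.coe_fn_mk]
      ring
  simpa only [Fintype.sum_prod_type] using this

/-- A complex vector padded with zeros. -/
def padVecC {m : ℕ} (k : ℕ) (v : Fin m → ℂ) : Fin k → ℂ :=
  fun i => if h : (i : ℕ) < m then v ⟨i, h⟩ else 0

theorem sum_castLE {M : Type*} [AddCommMonoid M] {m N : ℕ} (h : m ≤ N) {f : Fin N → M}
    (hf : ∀ i : Fin N, m ≤ i → f i = 0) : ∑ i, f (Fin.castLE h i) = ∑ i, f i := by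
  refine Fintype.sum_of_injective (Fin.castLE h) (Fin.castLE_injective h) _ _ (fun i hi => ?_)
    fun _ => rfl
  refine hf i (le_of_not_gt fun hlt => hi ⟨⟨i, hlt⟩, rfl⟩)

/-- Parseval's identity for a vector `r` in the span of the first two vectors of an orthonormal
basis, with these two vectors rotated by a unitary matrix of size two. -/
theorem normSq_eq_add_of_vecMul_eq_zero {N : ℕ} (hN : 2 ≤ N) {U : Matrix (Fin N) (Fin N) ℂ}
    (hU : U * Uᴴ = 1) {r : Fin N → ℂ} (hr : ∀ i : Fin N, 2 ≤ (i : ℕ) → (r ᵥ* U) i = 0)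
    {v : Fin 2 → ℂ} (hv : normSq v = 1) :
    normSq r = ‖r ⬝ᵥ (U.submatrix id (Fin.castLE hN) *ᵥ v)‖ ^ 2 +
      ‖r ⬝ᵥ (U.submatrix id (Fin.castLE hN) *ᵥ ![-star (v 1), star (v 0)])‖ ^ 2 := by
  have h₁ : normSq (r ᵥ* U) = normSq r := by
    rw [← Matrix.mulVec_transpose]
    refine normSq_mulVec_of_conjTranspose_mul_self ?_ r
    rw [← Matrix.transpose_one, ← hU, Matrix.transpose_mul]
    rfl
  have h₂ : ∀ w : Fin 2 → ℂ, r ⬝ᵥ (U.submatrix id (Fin.castLE hN) *ᵥ w) =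
      (r ᵥ* U) (Fin.castLE hN 0) * w 0 + (r ᵥ* U) (Fin.castLE hN 1) * w 1 := by
    intro w
    rw [Matrix.dotProduct_mulVec]
    simp [dotProduct, Fin.sum_univ_two, Matrix.vecMul]
  have h₃ : normSq (r ᵥ* U) = ∑ i : Fin 2, ‖(r ᵥ* U) (Fin.castLE hN i)‖ ^ 2 :=
    (sum_castLE hN (f := fun i => ‖(r ᵥ* U) i‖ ^ 2) fun i hi => by simp [hr i hi]).symm
  rw [← h₁, h₃, h₂, h₂, Fin.sum_univ_two]
  generalize (r ᵥ* U) (Fin.castLE hN 0) = p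
  generalize (r ᵥ* U) (Fin.castLE hN 1) = q
  rw [normSq, Fin.sum_univ_two] at hv
  simp only [Complex.sq_norm, Complex.normSq_apply, Matrix.cons_val_zero, Matrix.cons_val_one,
    Complex.add_re, Complex.add_im, Complex.mul_re, Complex.mul_im, Complex.neg_re,
    Complex.neg_im, Complex.star_def, Complex.conj_re, Complex.conj_im] at hv ⊢
  -- The matrix with rows `v` and `![-star (v 1), star (v 0)]` is unitary up to the factor `normSq
  -- v`, which is `1`.
  linear_combination (-(p.re * p.re + p.im * p.im + (q.re * q.re + q.im * q.im))) * hv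

/-- `V` and `E` consist of the leading eigenvectors of `μ₁` and `μ₂`. A vanishing contraction would
concentrate a slice of squared norm `t / (c - 1)` in a single vector of the third factor, more than
the largest eigenvalue `1 / c` of `μ₃` allows. -/
theorem exists_contract_ne_zero {N c : ℕ} (hc : 3 ≤ c) (hcN : c ≤ N) {S : Tensor N N N}
    (hS : S ≠ 0) (hspec : specMoment S = uniformPoint c N) :
    ∃ (V : Matrix (Fin N) (Fin 2) ℂ) (E : Matrix (Fin N) (Fin (c - 1)) ℂ),
      ∀ v w, normSq v = 1 → normSq w = 1 → contract S (V *ᵥ v) (E *ᵥ w) ≠ 0 := by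
  obtain ⟨hs₁, hs₂, hs₃⟩ : _ ∧ _ ∧ _ := by
    simpa only [specMoment, uniformPoint, Prod.mk.injEq] using hspec
  have hN : 2 ≤ N := by omega
  have hcN' : c - 1 ≤ N := by omega
  set t : ℝ := ∑ i, ∑ j, ∑ k, ‖S i j k‖ ^ 2 with ht_def
  have ht : 0 < t := by
    obtain ⟨i, hi⟩ := Function.ne_iff.1 hS
    obtain ⟨j, hj⟩ := Function.ne_iff.1 hi
    obtain ⟨k, hk⟩ := Function.ne_iff.1 hj
    refine Finset.sum_pos' (fun _ _ => by positivity) ⟨i, Finset.mem_univ _, ?_⟩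
    refine Finset.sum_pos' (fun _ _ => by positivity) ⟨j, Finset.mem_univ _, ?_⟩
    refine Finset.sum_pos' (fun _ _ => by positivity) ⟨k, Finset.mem_univ _, ?_⟩
    have : 0 < ‖S i j k‖ := norm_pos_iff.2 hk
    positivity
  obtain ⟨U₁, hU₁, hU₁', hq₁⟩ := exists_unitary_normSq_mulVec (flattening₁ S) ht (by
    rw [Finset.sum_comm, ht_def]; simp_rw [Fintype.sum_prod_type]; rfl)
  obtain ⟨U₂, hU₂, hU₂', hq₂⟩ := exists_unitary_normSq_mulVec (flattening₂ S) ht (by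
    rw [Fintype.sum_prod_type, ht_def]
    exact Finset.sum_congr rfl fun i _ => Finset.sum_comm)
  obtain ⟨U₃, hU₃, hU₃', hq₃⟩ := exists_unitary_normSq_mulVec (flattening₃ S) ht (by
    rw [Fintype.sum_prod_type, ht_def]; rfl)
  rw [hs₁] at hq₁
  rw [hs₂] at hq₂
  rw [hs₃] at hq₃
  -- Eigenvectors of `μ₁` with eigenvalue `0` are annihilated by the flattening itself, so in the
  -- first factor only the first two basis vectors matter.
  have hslice : ∀ i : Fin N, 2 ≤ (i : ℕ) → ∀ j k, ∑ i', S i' j k * U₁ i' i = 0 := by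
    intro i hi j k
    have h := hq₁ (Pi.single i 1)
    rw [Finset.sum_eq_zero, mul_zero, normSq_eq_zero] at h
    · rw [Matrix.mulVec_single_one] at h
      exact congrFun h (j, k)
    · intro l _
      by_cases hl : l = i
      · subst hl
        simp [uniformVec, not_lt.2 hi]
      · simp [hl]
  refine ⟨U₁.submatrix id (Fin.castLE hN), U₂.submatrix id (Fin.castLE hcN'), ?_⟩
  intro v w hv hw hvw
  set u := U₁.submatrix id (Fin.castLE hN) *ᵥ v with hu
  set u' := U₁.submatrix id (Fin.castLE hN) *ᵥ ![-star (v 1), star (v 0)] with hu'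
  have hx : U₂.submatrix id (Fin.castLE hcN') *ᵥ w = U₂ *ᵥ padVecC N w := by
    funext i
    simp only [Matrix.mulVec, dotProduct, Matrix.submatrix_apply, id]
    rw [← sum_castLE hcN']
    · simp [padVecC]
    · intro j hj
      simp [padVecC, not_lt.2 hj]
  have hw' : normSq (padVecC N w) = 1 := by
    rw [← hw, normSq, normSq, ← sum_castLE hcN']
    · simp [padVecC]
    · intro j hj
      simp [padVecC, not_lt.2 hj]
  rw [hx] at hvw
  set x := U₂ *ᵥ padVecC N w with hx_def
  have hxn : normSq x = 1 := by
    rw [hx_def, normSq_mulVec_of_conjTranspose_mul_self hU₂, hw']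
  set z := contract S u' x with hz
  have hc1 : (0 : ℝ) < ((c - 1 : ℕ) : ℝ) := by exact_mod_cast (by omega : 0 < c - 1)
  -- The padded `w` is supported where the spectrum of `μ₂` is constantly `1 / (c - 1)`, so this is
  -- an equality.
  have hM₂ : normSq (flattening₂ S *ᵥ x) = t * (1 / ((c - 1 : ℕ) : ℝ)) := by
    rw [hx_def, hq₂]
    congr 1
    refine Eq.trans ?_ ((congrArg (1 / ((c - 1 : ℕ) : ℝ) * ·) hw').trans (mul_one _))
    simp only [normSq, Finset.mul_sum]
    refine Finset.sum_congr rfl fun i _ => ?_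
    by_cases hi : (i : ℕ) < c - 1
    · simp [uniformVec, hi]
    · simp [padVecC, hi]
  have hdot₂ : ∀ k a, (fun i => ∑ j, S i j k * x j) ⬝ᵥ a = contract S a x k := by
    intro k a
    simp only [dotProduct, contract, Finset.sum_mul]
    exact Finset.sum_congr rfl fun i _ => Finset.sum_congr rfl fun j _ => by ring
  -- Parseval in the basis `u`, `u'` for each third index: the `u` part vanishes by assumption.
  have hz_norm : normSq z = t * (1 / ((c - 1 : ℕ) : ℝ)) := by
    rw [← hM₂, normSq, normSq, Fintype.sum_prod_type, Finset.sum_comm]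
    refine Finset.sum_congr rfl fun k _ => ?_
    have h := normSq_eq_add_of_vecMul_eq_zero hN hU₁' (r := fun i => ∑ j, S i j k * x j) ?_ hv
    · rw [hdot₂, hdot₂, ← hu, ← hu', hvw, Pi.zero_apply, norm_zero, ← hz] at h
      rw [zero_pow two_ne_zero, zero_add] at h
      exact h.symm
    · intro i hi
      simp only [Matrix.vecMul, dotProduct, Finset.sum_mul]
      rw [Finset.sum_comm]
      refine Finset.sum_eq_zero fun j _ => ?_
      simp_rw [mul_right_comm _ (x j)]
      rw [← Finset.sum_mul, hslice i hi, zero_mul]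
  -- Contractions are bilinear, so the conjugate of `z` is the vector whose pairing with `z` is
  -- `normSq z`.
  set y : Fin N → ℂ := star z with hy
  have hyn : normSq y = normSq z := by simp [hy, normSq]
  have hM₃ : normSq (flattening₃ S *ᵥ y) ≤ t * (1 / (c : ℝ)) * normSq z := by
    have hy' : y = U₃ *ᵥ (U₃ᴴ *ᵥ y) := by rw [Matrix.mulVec_mulVec, hU₃', Matrix.one_mulVec]
    have hn : normSq (U₃ᴴ *ᵥ y) = normSq z := by
      rw [normSq_mulVec_of_conjTranspose_mul_self _ y, hyn]
      rwa [Matrix.conjTranspose_conjTranspose]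
    rw [hy', hq₃, mul_assoc, ← hn]
    refine mul_le_mul_of_nonneg_left ?_ ht.le
    rw [normSq, Finset.mul_sum]
    refine Finset.sum_le_sum fun i _ => ?_
    refine mul_le_mul_of_nonneg_right ?_ (by positivity)
    rw [uniformVec]
    split_ifs
    · exact le_rfl
    · positivity
  have hle : normSq (fun j => (fun i => ∑ k, S i j k * y k) ⬝ᵥ u') ≤
      normSq (flattening₃ S *ᵥ y) := by
    rw [normSq, normSq, Fintype.sum_prod_type, Finset.sum_comm]
    refine Finset.sum_le_sum fun j _ => ?_
    have h := normSq_eq_add_of_vecMul_eq_zero hN hU₁' (r := fun i => ∑ k, S i j k * y k) ?_ hv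
    · refine (le_add_of_nonneg_left (by positivity)).trans h.symm.le
    · intro i hi
      simp only [Matrix.vecMul, dotProduct, Finset.sum_mul]
      rw [Finset.sum_comm]
      refine Finset.sum_eq_zero fun k _ => ?_
      simp_rw [mul_right_comm _ (y k)]
      rw [← Finset.sum_mul, hslice i hi, zero_mul]
  have hpair : x ⬝ᵥ (fun j => (fun i => ∑ k, S i j k * y k) ⬝ᵥ u') = (normSq z : ℂ) := by
    rw [dotProduct_contract, ofReal_normSq]
  have hcs := norm_dotProduct_sq_le x (fun j => (fun i => ∑ k, S i j k * y k) ⬝ᵥ u')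
  -- Cauchy–Schwarz now reads `‖z‖⁴ ≤ ‖S(u', ·, y)‖²`, and the right side is at most `‖S(·, ·, y)‖²
  -- ≤ (t / c) ‖z‖²`.
  rw [hpair, hxn, one_mul, Complex.norm_real, Real.norm_eq_abs, sq_abs] at hcs
  have hpos : 0 < normSq z := by rw [hz_norm]; exact mul_pos ht (one_div_pos.2 hc1)
  have hfin : normSq z ≤ t * (1 / (c : ℝ)) :=
    le_of_mul_le_mul_right (by rw [← sq]; exact hcs.trans (hle.trans hM₃)) hpos
  rw [hz_norm] at hfin
  have hlt : 1 / (c : ℝ) < 1 / ((c - 1 : ℕ) : ℝ) :=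
    one_div_lt_one_div_of_lt hc1 (by exact Nat.cast_lt.2 (by omega))
  exact absurd hfin (not_le.2 (mul_lt_mul_of_pos_left hlt ht))

theorem uniformPoint_notMem_momentPolytope_matMulTensor {n c : ℕ} (hc : 3 ≤ c)
    (hcn : c ≤ n * n) (hlt : n * n < c - 1 + n) :
    uniformPoint c (n * n) ∉ momentPolytope (matMulTensor n n n) := by
  rintro ⟨S, ⟨hS, hS0⟩, hspec⟩
  have hn : 0 < n := Nat.pos_of_ne_zero fun h => by subst h; omega
  obtain ⟨V, E, h⟩ := exists_contract_ne_zero hc hcn hS0 hspec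
  obtain ⟨v, w, hv, hw, hvw⟩ := exists_contract_eq_zero_of_mem_closure_orbit hn hlt V E hS
  exact h v w hv hw hvw

/-! ### Singular restrictions in the orbit closure -/

/-- `det (A + ε)` is the characteristic polynomial of `-A` at `ε`, which has finitely many roots. -/
theorem eventually_isUnit_add_smul_one {n : ℕ} (A : Matrix (Fin n) (Fin n) ℂ) :
    ∀ᶠ ε in 𝓝[≠] (0 : ℂ), IsUnit (A + ε • 1) := by
  have hfin : {ε : ℂ | (-A).charpoly.IsRoot ε}.Finite :=
    Polynomial.finite_setOfPred_isRoot (Matrix.charpoly_monic _).ne_zero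
  -- When `A` is singular, `0` is a root too; it is removed so that the complement of the remaining
  -- roots is a neighbourhood of `0`.
  have := (hfin.subset (Set.sdiff_subset (t := {0}))).isClosed.isOpen_compl.mem_nhds
    (x := (0 : ℂ)) (by simp)
  filter_upwards [nhdsWithin_le_nhds this, self_mem_nhdsWithin] with ε h hε
  rw [Matrix.isUnit_iff_isUnit_det, isUnit_iff_ne_zero]
  intro h0
  refine h ⟨?_, hε⟩
  rw [Set.mem_ofPred_eq, Polynomial.IsRoot, Matrix.eval_charpoly, ← h0, Matrix.scalar_apply,
    ← Matrix.smul_one_eq_diagonal, sub_neg_eq_add, add_comm]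

/-- All square restrictions of a tensor, also by singular matrices, are in its orbit closure. -/
theorem act_mem_closure_orbit {a b c : ℕ} (A : Matrix (Fin a) (Fin a) ℂ)
    (B : Matrix (Fin b) (Fin b) ℂ) (C : Matrix (Fin c) (Fin c) ℂ) (T : Tensor a b c) :
    act A B C T ∈ closure (orbit T) := by
  have hc : Continuous fun ε : ℂ => act (A + ε • 1) (B + ε • 1) (C + ε • 1) T := by
    unfold act
    simp only [Matrix.add_apply, Matrix.smul_apply]
    fun_prop
  have ht := (hc.tendsto 0).mono_left (nhdsWithin_le_nhds (s := {0}ᶜ))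
  simp only [zero_smul, add_zero] at ht
  refine mem_closure_of_tendsto ht ?_
  filter_upwards [eventually_isUnit_add_smul_one A, eventually_isUnit_add_smul_one B,
    eventually_isUnit_add_smul_one C] with ε hA hB hC
  exact ⟨hA.unit, hB.unit, hC.unit, rfl⟩

theorem act_unitTensor {r a b c : ℕ} (A : Matrix (Fin a) (Fin r) ℂ) (B : Matrix (Fin b) (Fin r) ℂ)
    (C : Matrix (Fin c) (Fin r) ℂ) (i : Fin a) (j : Fin b) (k : Fin c) :
    act A B C (unitTensor r) i j k = ∑ s, A i s * B j s * C k s := by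
  have h : ∀ x y z : Fin r, unitTensor r x y z = if x = y ∧ x = z then 1 else 0 := by
    intro x y z
    simp only [unitTensor, simpleTensor, Finset.sum_apply, Pi.single_apply, mul_ite, mul_one,
      mul_zero]
    by_cases hxy : x = y <;> by_cases hxz : x = z <;> simp_all [eq_comm]
  simp [act, h, ite_and]

/-! ### Multiplication of binary forms as a point of the unit tensor's polytope -/

/-- The squared coefficients of the balanced multiplication tensor of linear forms with forms of
degree `m`. -/
noncomputable def pencilWeight (m i j : ℕ) : ℝ := (m.choose j : ℝ) / ((m + 1).choose (i + j) : ℝ)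

/-- The multiplication tensor of binary linear forms with binary forms of degree `m`, in rescaled
bases. -/
noncomputable def pencil (m : ℕ) : Tensor (m + 2) (m + 2) (m + 2) := fun i j k =>
  if (i : ℕ) < 2 ∧ (j : ℕ) < m + 1 ∧ (i : ℕ) + j = k then
    ((√(m.choose j) : ℝ) : ℂ) * (((√((m + 1).choose k))⁻¹ : ℝ) : ℂ) else 0

/-- A product of degree at most `m + 1` is determined by its values at the `m + 2` nodes `0, …, m +
1`. The first two matrices evaluate the factors there, `⟨m + 2⟩` multiplies the values pointwise,
and the inverse Vandermonde matrix interpolates. The square roots of binomials rescale the monomials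
to unit vectors for the invariant norms. -/
theorem pencil_mem_closure_orbit (m : ℕ) : pencil m ∈ closure (orbit (unitTensor (m + 2))) := by
  let V : Matrix (Fin (m + 2)) (Fin (m + 2)) ℂ := Matrix.vandermonde fun s => ((s : ℕ) : ℂ)
  have hV : IsUnit V.det := isUnit_iff_ne_zero.2 <| Matrix.det_vandermonde_ne_zero_iff.2
    fun s s' h => Fin.ext (Nat.cast_injective h)
  have hV' : ∀ k l : Fin (m + 2),
      ∑ s : Fin (m + 2), V⁻¹ k s * ((s : ℕ) : ℂ) ^ (l : ℕ) = if k = l then 1 else 0 := by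
    intro k l
    have := congrFun (congrFun (Matrix.nonsing_inv_mul V hV) k) l
    rwa [Matrix.one_apply] at this
  convert act_mem_closure_orbit
    (Matrix.of fun i s : Fin (m + 2) => if (i : ℕ) < 2 then ((s : ℕ) : ℂ) ^ (i : ℕ) else 0)
    (Matrix.of fun j s : Fin (m + 2) =>
      if (j : ℕ) < m + 1 then ((√(m.choose j) : ℝ) : ℂ) * ((s : ℕ) : ℂ) ^ (j : ℕ) else 0)
    (Matrix.of fun k s => (((√((m + 1).choose k))⁻¹ : ℝ) : ℂ) * V⁻¹ k s) (unitTensor (m + 2))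
    using 1
  funext i j k
  rw [act_unitTensor, pencil]
  simp only [Matrix.of_apply]
  by_cases hi : (i : ℕ) < 2
  · by_cases hj : (j : ℕ) < m + 1
    · have := hV' k ⟨i + j, by omega⟩
      simp only [Fin.ext_iff, eq_comm (a := (k : ℕ))] at this
      simp only [hi, hj, true_and, if_true]
      calc _ = ((√(m.choose j) : ℝ) : ℂ) * (((√((m + 1).choose k))⁻¹ : ℝ) : ℂ) *
            (if (i : ℕ) + j = k then 1 else 0) := by split_ifs <;> simp
        _ = _ := by
          rw [← this, Finset.mul_sum]
          exact Finset.sum_congr rfl fun s _ => by rw [pow_add]; ring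
    · simp [hj]
  · simp [hi]

theorem norm_pencil_sq (m : ℕ) (i j k : Fin (m + 2)) : ‖pencil m i j k‖ ^ 2 =
    if (i : ℕ) < 2 ∧ (j : ℕ) < m + 1 ∧ (i : ℕ) + j = k then pencilWeight m i j else 0 := by
  rw [pencil]
  split_ifs with h
  · rw [norm_mul, Complex.norm_real, Complex.norm_real, mul_pow, Real.norm_eq_abs,
      Real.norm_eq_abs, sq_abs, sq_abs, inv_pow, Real.sq_sqrt (by positivity),
      Real.sq_sqrt (by positivity), pencilWeight, h.2.2, div_eq_mul_inv]
  · simp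

theorem pencilWeight_zero {m j : ℕ} (hj : j ≤ m) :
    pencilWeight m 0 j = ((m : ℝ) + 1 - j) / (m + 1) := by
  have h := Nat.choose_mul_succ_eq m j
  have h' : (m.choose j : ℝ) * (m + 1) = (m + 1).choose j * ((m : ℝ) + 1 - j) := by
    have := congrArg (Nat.cast (R := ℝ)) h
    push_cast [Nat.cast_sub (show j ≤ m + 1 by omega)] at this
    exact this
  have hp : ((m + 1).choose j : ℝ) ≠ 0 := by
    exact_mod_cast (Nat.choose_pos (show j ≤ m + 1 by omega)).ne'
  rw [pencilWeight, zero_add, div_eq_div_iff hp (by positivity), h', mul_comm]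

theorem pencilWeight_one {m j : ℕ} (hj : j ≤ m) :
    pencilWeight m 1 j = ((j : ℝ) + 1) / (m + 1) := by
  have h := Nat.add_one_mul_choose_eq m j
  have h' : ((m : ℝ) + 1) * (m.choose j : ℝ) = (m + 1).choose (j + 1) * ((j : ℝ) + 1) := by
    exact_mod_cast h
  have hp : ((m + 1).choose (j + 1) : ℝ) ≠ 0 := by
    exact_mod_cast (Nat.choose_pos (show j + 1 ≤ m + 1 by omega)).ne'
  rw [pencilWeight, add_comm 1 j, div_eq_div_iff hp (by positivity), mul_comm, h', mul_comm]

theorem sum_norm_pencil_sq_right (m : ℕ) (i j : Fin (m + 2)) : ∑ k, ‖pencil m i j k‖ ^ 2 =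
    if (i : ℕ) < 2 ∧ (j : ℕ) < m + 1 then pencilWeight m i j else 0 := by
  simp only [norm_pencil_sq]
  by_cases h : (i : ℕ) < 2 ∧ (j : ℕ) < m + 1
  · rw [Finset.sum_eq_single (⟨i + j, by omega⟩ : Fin (m + 2))]
    · simp [h]
    · intro k _ hk
      rw [if_neg]
      rintro ⟨-, -, h'⟩
      exact hk (Fin.ext h'.symm)
    · simp
  · rw [if_neg h]
    exact Finset.sum_eq_zero fun k _ => if_neg fun h' => h ⟨h'.1, h'.2.1⟩

theorem sum_norm_pencil_sq₁ (m : ℕ) (i : Fin (m + 2)) :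
    ∑ j, ∑ k, ‖pencil m i j k‖ ^ 2 = (m + 2 : ℝ) * uniformVec 2 (m + 2) i := by
  simp only [sum_norm_pencil_sq_right]
  have hsum : ∀ n : ℕ, ∑ j ∈ Finset.range n, (j : ℝ) = n * (n - 1) / 2 := by
    intro n
    induction n with
    | zero => simp
    | succ n ih => rw [Finset.sum_range_succ, ih]; push_cast; ring
  have hm : (m : ℝ) + 1 ≠ 0 := by positivity
  by_cases hi : (i : ℕ) < 2
  · rw [Fin.sum_univ_castSucc]
    simp only [hi, Fin.val_castSucc, Fin.is_lt, Fin.val_last, lt_irrefl, and_true, and_false,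
      if_true, if_false, add_zero, uniformVec]
    rw [Fin.sum_univ_eq_sum_range (fun j => pencilWeight m i j) (m + 1)]
    obtain h0 | h1 : (i : ℕ) = 0 ∨ (i : ℕ) = 1 := by omega
    · rw [h0, Finset.sum_congr rfl fun j hj =>
        pencilWeight_zero (Nat.le_of_lt_succ (Finset.mem_range.1 hj)), ← Finset.sum_div,
        Finset.sum_sub_distrib, hsum]
      simp only [Finset.sum_const, Finset.card_range, nsmul_eq_mul]
      push_cast
      field_simp
      ring
    · rw [h1, Finset.sum_congr rfl fun j hj =>
        pencilWeight_one (Nat.le_of_lt_succ (Finset.mem_range.1 hj)), ← Finset.sum_div,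
        Finset.sum_add_distrib, hsum]
      simp only [Finset.sum_const, Finset.card_range, nsmul_eq_mul]
      push_cast
      field_simp
      ring
  · simp [hi, uniformVec]

theorem sum_norm_pencil_sq₂ (m : ℕ) (j : Fin (m + 2)) :
    ∑ i, ∑ k, ‖pencil m i j k‖ ^ 2 = (m + 2 : ℝ) * uniformVec (m + 1) (m + 2) j := by
  simp only [sum_norm_pencil_sq_right]
  have hm : (m : ℝ) + 1 ≠ 0 := by positivity
  rw [Fin.sum_univ_succ, Fin.sum_univ_succ]
  by_cases hj : (j : ℕ) < m + 1
  · simp [hj, uniformVec, pencilWeight_zero (Nat.le_of_lt_succ hj),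
      pencilWeight_one (Nat.le_of_lt_succ hj)]
    field_simp
    ring
  · simp [hj, uniformVec]

theorem sum_norm_pencil_sq_middle (m : ℕ) (i k : Fin (m + 2)) : ∑ j, ‖pencil m i j k‖ ^ 2 =
    if (i : ℕ) < 2 ∧ (i : ℕ) ≤ k ∧ (k : ℕ) - i < m + 1 then pencilWeight m i (k - i) else 0 := by
  simp only [norm_pencil_sq]
  split_ifs with h
  · rw [Finset.sum_eq_single (⟨k - i, by omega⟩ : Fin (m + 2))]
    · rw [if_pos ⟨h.1, h.2.2, by simp only; omega⟩]
    · intro j _ hj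
      rw [if_neg]
      rintro ⟨-, -, h'⟩
      exact hj (Fin.ext (by simp only; omega))
    · simp
  · exact Finset.sum_eq_zero fun j _ => if_neg fun h' => h ⟨h'.1, by omega, by omega⟩

/-- For `0 < k < m + 1` the two contributions are `(m + 1 - k) / (m + 1)` and `k / (m + 1)`, with
sum `1`; at either end a single contribution equals `1`. -/
theorem sum_norm_pencil_sq₃ (m : ℕ) (k : Fin (m + 2)) :
    ∑ i, ∑ j, ‖pencil m i j k‖ ^ 2 = (m + 2 : ℝ) * uniformVec (m + 2) (m + 2) k := by
  simp only [sum_norm_pencil_sq_middle]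
  have hm : (m : ℝ) + 1 ≠ 0 := by positivity
  have hm' : (m : ℝ) + 2 ≠ 0 := by positivity
  rw [Fin.sum_univ_succ, Fin.sum_univ_succ]
  have hrhs : (m + 2 : ℝ) * uniformVec (m + 2) (m + 2) k = 1 := by
    simp [uniformVec, hm']
  rw [hrhs]
  obtain h0 | ⟨h1, h2⟩ | h3 :
      (k : ℕ) = 0 ∨ (1 ≤ (k : ℕ) ∧ (k : ℕ) < m + 1) ∨ (k : ℕ) = m + 1 := by omega
  · simp [h0, pencilWeight_zero (Nat.zero_le m), hm]
  · have h4 : (k : ℕ) - 1 < m + 1 := by omega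
    simp [h1, h2, h4, pencilWeight_zero (Nat.le_of_lt_succ h2),
      pencilWeight_one (Nat.le_of_lt_succ h4), Nat.cast_sub h1]
    field_simp
    ring
  · simp [h3, pencilWeight_one le_rfl, hm]

theorem uniformVec_antitone (m k : ℕ) : Antitone (uniformVec m k) := by
  intro i j hij
  have hij' : (i : ℕ) ≤ j := hij
  simp only [uniformVec]
  split_ifs
  · exact le_rfl
  · omega
  · positivity
  · exact le_rfl

/-- A criterion for the spectrum of the normalised Gram matrix, when the columns of `M` have
disjoint supports. -/
theorem spec_normalizedGram_eq {ι : Type*} [Fintype ι] {n : ℕ} (M : Matrix ι (Fin n) ℂ)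
    {t : ℝ} {d : Fin n → ℝ} (hd : Antitone d) (ht : t ≠ 0) (hsum : ∑ i, d i = 1)
    (hM : ∀ p i j, M p i ≠ 0 → M p j ≠ 0 → i = j) (h : ∀ i, ∑ p, ‖M p i‖ ^ 2 = t * d i) :
    spec (normalizedGram_isHermitian M) = d := by
  refine spec_eq_of_eq_diagonal _ hd ?_
  have htr : ∑ p, ∑ i, ‖M p i‖ ^ 2 = t := by
    rw [Finset.sum_comm]
    simp only [h]
    rw [← Finset.mul_sum, hsum, mul_one]
  have ht' : (t : ℂ) ≠ 0 := by exact_mod_cast ht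
  ext i j
  rw [normalizedGram, trace_conjTranspose_mul_self, htr, Matrix.smul_apply, Matrix.mul_apply,
    smul_eq_mul]
  by_cases hij : i = j
  · subst hij
    rw [Matrix.diagonal_apply_eq, inv_mul_eq_iff_eq_mul₀ ht', ← Complex.ofReal_mul, ← h i]
    simp [Complex.conj_mul']
  · rw [Matrix.diagonal_apply_ne _ hij, Finset.sum_eq_zero, mul_zero]
    intro p _
    by_contra hne
    obtain ⟨h₁, h₂⟩ := mul_ne_zero_iff.1 hne
    exact hij (hM p i j (by simpa using h₁) h₂)

theorem sum_uniformVec {m k : ℕ} (hm : 0 < m) (hmk : m ≤ k) : ∑ i, uniformVec m k i = 1 := by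
  have hm' : (m : ℝ) ≠ 0 := by exact_mod_cast hm.ne'
  simp only [uniformVec]
  rw [Fin.sum_univ_eq_sum_range (fun i => if i < m then 1 / (m : ℝ) else 0) k,
    ← Finset.sum_filter]
  have : (Finset.range k).filter (· < m) = Finset.range m := by
    ext i; simp only [Finset.mem_filter, Finset.mem_range]; omega
  rw [this]
  simp [hm']

theorem pencil_ne_zero_iff {m : ℕ} {i j k : Fin (m + 2)} (h : pencil m i j k ≠ 0) :
    (i : ℕ) + j = k := by
  by_contra hne
  exact h (by rw [pencil, if_neg fun h' => hne h'.2.2])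

/-- Entries are nonzero only if `i + j = k`, so two indices determine the third. Hence the columns
of each flattening have disjoint supports, the Gram matrices are diagonal, and the marginal sums are
the spectra up to the total `m + 2`. -/
theorem specMoment_pencil (m : ℕ) : specMoment (pencil m) = uniformPoint (m + 2) (m + 2) := by
  have ht : (m + 2 : ℝ) ≠ 0 := by positivity
  refine Prod.ext ?_ (Prod.ext ?_ ?_)
  · refine spec_normalizedGram_eq _ (uniformVec_antitone _ _) ht
      (sum_uniformVec (by omega) (by omega)) (fun p i j hi hj => ?_) fun i => ?_
    · have := pencil_ne_zero_iff hi
      have := pencil_ne_zero_iff hj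
      exact Fin.ext (by omega)
    · rw [Fintype.sum_prod_type]
      exact sum_norm_pencil_sq₁ m i
  · refine spec_normalizedGram_eq _ (uniformVec_antitone _ _) ht
      (sum_uniformVec (by omega) (by omega)) (fun p i j hi hj => ?_) fun i => ?_
    · have := pencil_ne_zero_iff hi
      have := pencil_ne_zero_iff hj
      exact Fin.ext (by omega)
    · rw [Fintype.sum_prod_type]
      exact sum_norm_pencil_sq₂ m i
  · refine spec_normalizedGram_eq _ (uniformVec_antitone _ _) ht
      (sum_uniformVec (by omega) (by omega)) (fun p i j hi hj => ?_) fun i => ?_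
    · have := pencil_ne_zero_iff hi
      have := pencil_ne_zero_iff hj
      exact Fin.ext (by omega)
    · rw [Fintype.sum_prod_type]
      exact sum_norm_pencil_sq₃ m i

theorem uniformPoint_mem_momentPolytope_unitTensor {c : ℕ} (hc : 2 ≤ c) :
    uniformPoint c c ∈ momentPolytope (unitTensor c) := by
  obtain ⟨m, rfl⟩ := Nat.exists_eq_add_of_le' hc
  refine ⟨pencil m, ⟨pencil_mem_closure_orbit m, fun h => ?_⟩, specMoment_pencil m⟩
  have := sum_norm_pencil_sq₃ m 0
  rw [Set.mem_singleton_iff.1 h] at this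
  have hm' : (m : ℝ) + 2 ≠ 0 := by positivity
  simp [uniformVec, hm'] at this

theorem padPoint_uniformPoint {c k : ℕ} (hc : 2 ≤ c) :
    padPoint k (uniformPoint c c) = uniformPoint c k := by
  have h : ∀ m ≤ c, padVec k (uniformVec m c) = uniformVec m k := by
    intro m hm
    funext i
    simp only [padVec, uniformVec]
    split_ifs <;> first | rfl | omega
  simp only [padPoint, uniformPoint]
  rw [h 2 hc, h (c - 1) (Nat.sub_le _ _), h c le_rfl]

end MomentPolytope

theorem theorem1p2 :
    (∀ n c : ℕ, n ^ 2 - n + 1 < c → c ≤ n ^ 2 →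
      MomentPolytope.uniformPoint c c ∈
        MomentPolytope.momentPolytope (MomentPolytope.unitTensor c) ∧
      MomentPolytope.uniformPoint c (n * n) ∉
        MomentPolytope.momentPolytope (MomentPolytope.matMulTensor n n n) ∧
      ¬ (MomentPolytope.padPoint (n * n) ''
          MomentPolytope.momentPolytope (MomentPolytope.unitTensor c) ⊆
        MomentPolytope.momentPolytope (MomentPolytope.matMulTensor n n n))) ∧
    (∀ n : ℕ, 2 ≤ n →
      ¬ (MomentPolytope.momentPolytope (MomentPolytope.unitTensor (n * n)) ⊆
        MomentPolytope.momentPolytope (MomentPolytope.matMulTensor n n n))) := by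
  constructor
  · intro n c h₁ h₂
    rw [pow_two] at h₁ h₂
    -- For `n = 0` and `n = 1` the range of `c` is empty, also with truncated subtraction.
    have hn : 2 ≤ n := by
      by_contra h
      interval_cases n <;> omega
    have hnn : 2 * n ≤ n * n := Nat.mul_le_mul_right n hn
    have hmem := MomentPolytope.uniformPoint_mem_momentPolytope_unitTensor
      (show 2 ≤ c by omega)
    have hnot := MomentPolytope.uniformPoint_notMem_momentPolytope_matMulTensor
      (n := n) (c := c) (by omega) h₂ (by omega)
    refine ⟨hmem, hnot, fun h => hnot (h ⟨_, hmem, ?_⟩)⟩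
    exact MomentPolytope.padPoint_uniformPoint (by omega)
  · intro n hn h
    have hnn : 2 * n ≤ n * n := Nat.mul_le_mul_right n hn
    exact MomentPolytope.uniformPoint_notMem_momentPolytope_matMulTensor
      (n := n) (c := n * n) (by omega) le_rfl (by omega)
      (h (MomentPolytope.uniformPoint_mem_momentPolytope_unitTensor (by omega)))
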